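/- Let $\Bbbk$ be a field of characteristic $0$, let $n_1,\dots,n_d$ and $r_1,\dots,r_m$ be positive integers, and put $R=r_1\cdots r_m$. A tensor $\mathcal A\in\Bbbk^{n_1\times\cdots\times n_d}$ has rank $1$ if it is nonzero and of the form $\mathbf a_1\otimes\cdots\otimes\mathbf a_d$ with $\mathbf a_i\in\Bbbk^{n_i}$; the rank of $\mathcal T$ is the least number of rank-$1$ tensors with sum $\mathcal T$. A tensor $\mathcal T$ is called $R$-identifiable if it has rank $R$ and there is, up to order, exactly one $R$-tuple of rank-$1$ tensors with sum $\mathcal T$. Let $\sigma^\circ_{\mathbf r}$ be the set of all Hadamard (entrywise) products $\mathcal T_1\odot\cdots\odot\mathcal T_m$ of tensors $\mathcal T_k\in\Bbbk^{n_1\times\cdots\times n_d}$ with $\operatorname{rank}\mathcal T_k\le r_k$, and let $\sigma_{\mathbf r}$ be its Zariski closure in $\Bbbk^{n_1\times\cdots\times n_d}$. Suppose that there is a partition $I\sqcup J\sqcup K=\{1,\dots,d\}$ such that, with $\Pi_X:=\prod_{x\in X}n_x$, $$\Pi_I\ge\Pi_J\ge\Pi_K\ge 2\quad\text{and}\quad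 R\le \Pi_I+\min\{\tfrac12\delta,\delta\},\qquad \delta:=\Pi_J+\Pi_K-\Pi_I-2 .$$ Then a generic tensor admitting such a decomposition is $R$-identifiable: there is a Zariski-closed set $Z\subsetneq\sigma_{\mathbf r}$ such that every $\mathcal T\in\sigma^\circ_{\mathbf r}\setminus Z$ is $R$-identifiable over $\Bbbk$. If moreover $\Bbbk$ is algebraically closed, then a generic tensor of $\sigma_{\mathbf r}$ is $R$-identifiable: there is a Zariski-closed set $Z\subsetneq\sigma_{\mathbf r}$ such that every $\mathcal T\in\sigma_{\mathbf r}\setminus Z$ is $R$-identifiable. -/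

import Mathlib

namespace HHD

/-- Tensors of shape `n₁ × ⋯ × n_d` with coefficients in `𝕜`, in coordinates.
The Hadamard product is the pointwise product of the function space. -/
abbrev Tensor (𝕜 : Type*) {d : ℕ} (n : Fin d → ℕ) : Type _ :=
  (∀ i : Fin d, Fin (n i)) → 𝕜

/-- The tensor product `a₁ ⊗ ⋯ ⊗ a_d` of vectors `aᵢ ∈ 𝕜^{nᵢ}`. -/
def outer {𝕜 : Type*} [Field 𝕜] {d : ℕ} {n : Fin d → ℕ}
    (a : ∀ i : Fin d, Fin (n i) → 𝕜) : Tensor 𝕜 n :=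
  fun j => ∏ i, a i (j i)

/-- Rank-1 tensors: nonzero tensor products of vectors. -/
def IsRankOne {𝕜 : Type*} [Field 𝕜] {d : ℕ} {n : Fin d → ℕ} (A : Tensor 𝕜 n) : Prop :=
  A ≠ 0 ∧ ∃ a : ∀ i : Fin d, Fin (n i) → 𝕜, A = outer a

/-- The decompositions of `T` as a sum of `r` rank-1 tensors, up to the order of the summands:
unordered `r`-tuples (with multiplicities) of rank-1 tensors with sum `T`. -/
def decompositions {𝕜 : Type*} [Field 𝕜] {d : ℕ} {n : Fin d → ℕ} (r : ℕ) (T : Tensor 𝕜 n) :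
    Set (Sym (Tensor 𝕜 n) r) :=
  {A | (∀ B ∈ A, IsRankOne B) ∧ (A : Multiset (Tensor 𝕜 n)).sum = T}

/-- The tensor rank: the least length of a decomposition into rank-1 tensors. -/
noncomputable def tensorRank {𝕜 : Type*} [Field 𝕜] {d : ℕ} {n : Fin d → ℕ}
    (T : Tensor 𝕜 n) : ℕ :=
  sInf {r : ℕ | (decompositions r T).Nonempty}

/-- The infimum defining `tensorRank` is over a nonempty set for tensors of positive order. -/
theorem exists_decomposition {𝕜 : Type*} [Field 𝕜] {d : ℕ} {n : Fin d → ℕ} (hd : 0 < d)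
    (T : Tensor 𝕜 n) : ∃ r, (decompositions r T).Nonempty := by
  classical
  let s : Finset (∀ i : Fin d, Fin (n i)) := Finset.univ.filter fun j => T j ≠ 0
  let M : Multiset (Tensor 𝕜 n) := s.val.map fun j => Pi.single j (T j)
  refine ⟨M.card, ⟨M, rfl⟩, ?_, ?_⟩
  · intro B hB
    have hB' : B ∈ M := hB
    obtain ⟨j, hj, rfl⟩ := Multiset.mem_map.1 hB'
    have hj' : T j ≠ 0 := (Finset.mem_filter.1 hj).2
    refine ⟨fun h => hj' (by simpa using congrFun h j), ?_⟩
    refine ⟨fun i => Pi.single (j i) (if i = ⟨0, hd⟩ then T j else 1), ?_⟩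
    funext l
    by_cases hl : l = j
    · subst hl
      simp [outer]
    · obtain ⟨i, hi⟩ := Function.ne_iff.1 hl
      rw [Pi.single_eq_of_ne hl]
      exact (Finset.prod_eq_zero (Finset.mem_univ i) (Pi.single_eq_of_ne hi _)).symm
  · change (∑ j ∈ s, Pi.single j (T j) : Tensor 𝕜 n) = T
    rw [Finset.sum_filter_of_ne (fun j _ h => by
      intro h0
      exact h (by rw [h0, Pi.single_zero]))]
    exact Finset.univ_sum_single T

/-- A tensor is `r`-identifiable if it has rank `r` and exactly one decomposition of length `r`,
up to the order of the summands. -/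
def IsIdentifiable {𝕜 : Type*} [Field 𝕜] {d : ℕ} {n : Fin d → ℕ} (r : ℕ)
    (T : Tensor 𝕜 n) : Prop :=
  tensorRank T = r ∧ ∃ A, decompositions r T = {A}

/-- The tensors that are Hadamard products `T₁ ⊙ ⋯ ⊙ T_m` with `rank T_k ≤ r_k`. -/
def hhdSet (𝕜 : Type*) [Field 𝕜] {d : ℕ} (n : Fin d → ℕ) {m : ℕ} (r : Fin m → ℕ) :
    Set (Tensor 𝕜 n) :=
  {T | ∃ F : Fin m → Tensor 𝕜 n, (∀ k, tensorRank (F k) ≤ r k) ∧ T = ∏ k, F k}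

/-- Zariski-closed subsets of the affine space `𝕜^ι`. -/
def IsZariskiClosed {𝕜 : Type*} [Field 𝕜] {ι : Type*} (Z : Set (ι → 𝕜)) : Prop :=
  ∃ I : Ideal (MvPolynomial ι 𝕜), Z = MvPolynomial.zeroLocus 𝕜 I

/-- The Zariski closure of a subset of the affine space `𝕜^ι`. -/
def zariskiClosure {𝕜 : Type*} [Field 𝕜] {ι : Type*} (S : Set (ι → 𝕜)) : Set (ι → 𝕜) :=
  MvPolynomial.zeroLocus 𝕜 (MvPolynomial.vanishingIdeal 𝕜 S)

/-- The variety `σ_r(S)`: the Zariski closure of the set of Hadamard products of tensors of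
rank at most `r₁, …, r_m`. -/
def hhdVariety (𝕜 : Type*) [Field 𝕜] {d : ℕ} (n : Fin d → ℕ) {m : ℕ} (r : Fin m → ℕ) :
    Set (Tensor 𝕜 n) :=
  zariskiClosure (hhdSet 𝕜 n r)

/-- `P` holds generically on `V`: it holds at all points of `V` outside a Zariski-closed
subset `Z ⊊ V`. -/
def Generically {𝕜 : Type*} [Field 𝕜] {ι : Type*} (V : Set (ι → 𝕜))
    (P : (ι → 𝕜) → Prop) : Prop :=
  ∃ Z : Set (ι → 𝕜), IsZariskiClosed Z ∧ Z ⊂ V ∧ ∀ x ∈ V, x ∉ Z → P x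

/-- `R` lies in the range of the reshaped Kruskal criterion for the blocks `I`, `J`, `K`:
with `Π_X = ∏_{x ∈ X} n_x` and `δ = Π_J + Π_K - Π_I - 2`, one has `Π_I ≥ Π_J ≥ Π_K ≥ 2` and
`R ≤ Π_I + min (δ / 2) δ`. -/
def InKruskalRange {d : ℕ} (n : Fin d → ℕ) (I J K : Finset (Fin d)) (R : ℕ) : Prop :=
  (∏ x ∈ J, n x) ≤ ∏ x ∈ I, n x ∧ (∏ x ∈ K, n x) ≤ ∏ x ∈ J, n x ∧ 2 ≤ ∏ x ∈ K, n x ∧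
    let δ : ℚ := (∏ x ∈ J, (n x : ℚ)) + (∏ x ∈ K, (n x : ℚ)) - (∏ x ∈ I, (n x : ℚ)) - 2
    (R : ℚ) ≤ (∏ x ∈ I, (n x : ℚ)) + min (1 / 2 * δ) δ

end HHD

/-!
The variety is the closure of the image of a polynomial map, `hadamardMap`, so over an algebraically
closed field `Ω` its generic point is the image of a parameter at which any prescribed nonzero
polynomial does not vanish: this is Chevalley's theorem together with the Nullstellensatz.
Expanding a Hadamard product by distributivity gives `R` tensor products, and grouping the indices
by `I`, `J`, `K` makes them tensor products of order three. The polynomial is chosen as a product of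
minors, so that for each block the vectors of these tensor products have the largest possible
Kruskal rank; the minors are nonzero because some powers of a variable, substituted for the
parameters, turn them into Vandermonde determinants. Kruskal's theorem then shows that the
decomposition is unique over `Ω`, hence over `𝕜`, where a decomposition of length `R` exists for
every member of `hhdSet`.
-/

namespace HHD

section GenericLift

open MvPolynomial

theorem nonempty_algHom_of_finiteType (Ω B : Type*) [Field Ω] [IsAlgClosed Ω] [CommRing B]
    [Nontrivial B] [Algebra Ω B] [Algebra.FiniteType Ω B] : Nonempty (B →ₐ[Ω] Ω) := by
  obtain ⟨m, hm⟩ := Ideal.exists_maximal B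
  let := Ideal.Quotient.field m
  have : Module.Finite Ω (B ⧸ m) := finite_of_finite_type_of_isJacobsonRing Ω (B ⧸ m)
  have e : (B ⧸ m) →ₐ[Ω] Ω := IsAlgClosed.lift
  exact ⟨e.comp (Ideal.Quotient.mkₐ Ω m)⟩

open TensorProduct in
theorem nonempty_algHom_of_mem_range_comap {A B Ω : Type*} [CommRing A] [CommRing B] [Algebra A B]
    [Algebra.FiniteType A B] [Field Ω] [IsAlgClosed Ω] [Algebra A Ω] {x : PrimeSpectrum A}
    (hx : x.asIdeal = RingHom.ker (algebraMap A Ω))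
    (hxB : x ∈ Set.range (PrimeSpectrum.comap (algebraMap A B))) : Nonempty (B →ₐ[A] Ω) := by
  have := (PrimeSpectrum.nontrivial_iff_mem_rangeComap (S := B) x).2 hxB
  let κΩ : x.asIdeal.ResidueField →ₐ[A] Ω := Ideal.ResidueField.liftₐ x.asIdeal (Algebra.ofId A Ω)
    hx.le (fun a ha => (show algebraMap A Ω a ≠ 0 from fun h0 => ha (hx ▸ h0)).isUnit)
  let := κΩ.toRingHom.toAlgebra
  have : IsScalarTower A x.asIdeal.ResidueField Ω := .of_algebraMap_eq fun a => (κΩ.commutes a).symm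
  have : Nontrivial (Ω ⊗[x.asIdeal.ResidueField] (x.asIdeal.ResidueField ⊗[A] B)) := inferInstance
  have : Nontrivial (Ω ⊗[A] B) :=
    (Algebra.TensorProduct.cancelBaseChange A x.asIdeal.ResidueField Ω Ω B).symm.toEquiv.nontrivial
  obtain ⟨u⟩ := nonempty_algHom_of_finiteType Ω (Ω ⊗[A] B)
  exact ⟨(u.restrictScalars A).comp Algebra.TensorProduct.includeRight⟩

theorem exists_mem_of_isConstructible {A : Type*} [CommRing A] {S : Set (PrimeSpectrum A)}
    (hS : Topology.IsConstructible S) {x : PrimeSpectrum A} (hx : x ∈ S) :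
    ∃ a ∉ x.asIdeal, ∀ y : PrimeSpectrum A, x.asIdeal ≤ y.asIdeal → a ∉ y.asIdeal → y ∈ S := by
  obtain ⟨C, rfl⟩ := PrimeSpectrum.exists_constructibleSetData_iff.mpr hS
  simp only [PrimeSpectrum.ConstructibleSetData.toSet, Set.mem_iUnion] at hx ⊢
  obtain ⟨D, hD, hx1, hx2⟩ := hx
  refine ⟨D.f, by simpa using hx2, fun y hxy hy => ⟨D, hD, ?_, by simpa using hy⟩⟩
  exact fun z hz => hxy (hx1 hz)

theorem exists_forall_nonempty_algHom (A B : Type*) [CommRing A] [IsNoetherianRing A] [CommRing B]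
    [IsDomain B] [Algebra A B] [Algebra.FiniteType A B] :
    ∃ a, algebraMap A B a ≠ 0 ∧ ∀ (Ω : Type*) [Field Ω] [IsAlgClosed Ω] [Algebra A Ω],
      RingHom.ker (algebraMap A B) ≤ RingHom.ker (algebraMap A Ω) → algebraMap A Ω a ≠ 0 →
        Nonempty (B →ₐ[A] Ω) := by
  have hc : Topology.IsConstructible (Set.range (PrimeSpectrum.comap (algebraMap A B))) :=
    PrimeSpectrum.isConstructible_range_comap <| RingHom.FinitePresentation.of_finiteType.1 <|
      RingHom.finiteType_algebraMap.2 inferInstance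
  obtain ⟨a, ha, H⟩ := exists_mem_of_isConstructible hc ⟨(⊥ : PrimeSpectrum B), rfl⟩
  refine ⟨a, fun h0 => ha (by simpa using h0), fun Ω _ _ _ hker hΩ => ?_⟩
  refine nonempty_algHom_of_mem_range_comap rfl
    (H ⟨RingHom.ker (algebraMap A Ω), RingHom.ker_isPrime _⟩ ?_ hΩ)
  exact fun f hf => hker (by simpa using hf)

theorem Generically.mono {𝕜 ι : Type*} [Field 𝕜] {V : Set (ι → 𝕜)} {P Q : (ι → 𝕜) → Prop}
    (hP : Generically V P) (h : ∀ x ∈ V, P x → Q x) : Generically V Q := by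
  obtain ⟨Z, hZ, hZV, H⟩ := hP
  exact ⟨Z, hZ, hZV, fun x hx hxZ => h x hx (H x hx hxZ)⟩

theorem generically_aeval_ne_zero {𝕜 ι : Type*} [Field 𝕜] {S : Set (ι → 𝕜)}
    {a : MvPolynomial ι 𝕜} (ha : ∃ x ∈ S, aeval x a ≠ 0) :
    Generically (zariskiClosure S) fun x => aeval x a ≠ 0 := by
  refine ⟨zeroLocus 𝕜 (vanishingIdeal 𝕜 S ⊔ Ideal.span {a}), ⟨_, rfl⟩,
    ⟨zeroLocus_anti_mono le_sup_left, fun hle => ?_⟩, fun x hx hxZ h0 => hxZ fun f hf => ?_⟩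
  · obtain ⟨x, hx, hxa⟩ := ha
    exact hxa (hle (zeroLocus_vanishingIdeal_le S hx) a
      (Ideal.mem_sup_right (Ideal.mem_span_singleton_self a)))
  · have hker : vanishingIdeal 𝕜 S ⊔ Ideal.span {a} ≤ RingHom.ker (aeval (R := 𝕜) x) :=
      sup_le hx ((Ideal.span_singleton_le_iff_mem _).2 h0)
    exact hker hf

theorem exists_forall_algHom_apply_ne_zero {A B : Type*} [CommRing A] [IsNoetherianRing A]
    [CommRing B] [IsDomain B] [Algebra A B] [Algebra.FiniteType A B] {b : B} (hb : b ≠ 0) :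
    ∃ a, algebraMap A B a ≠ 0 ∧ ∀ (Ω : Type*) [Field Ω] [IsAlgClosed Ω] [Algebra A Ω],
      RingHom.ker (algebraMap A B) ≤ RingHom.ker (algebraMap A Ω) → algebraMap A Ω a ≠ 0 →
        ∃ u : B →ₐ[A] Ω, u b ≠ 0 := by
  have hle : Submonoid.powers b ≤ nonZeroDivisors B :=
    powers_le_nonZeroDivisors_of_noZeroDivisors hb
  have : IsDomain (Localization.Away b) := IsLocalization.isDomain_localization hle
  have : Algebra.FiniteType A (Localization.Away b) := .trans (S := B) inferInstance inferInstance
  have hinj : Function.Injective (algebraMap B (Localization.Away b)) :=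
    IsLocalization.injective _ hle
  have htower (x : A) : algebraMap A (Localization.Away b) x = 0 ↔ algebraMap A B x = 0 := by
    rw [IsScalarTower.algebraMap_apply A B, map_eq_zero_iff _ hinj]
  obtain ⟨a, ha, H⟩ := exists_forall_nonempty_algHom A (Localization.Away b)
  refine ⟨a, (htower a).not.1 ha, fun Ω _ _ _ hker hΩ => ?_⟩
  obtain ⟨u⟩ := H Ω (fun x hx => hker ((htower x).1 hx)) hΩ
  exact ⟨u.comp (IsScalarTower.toAlgHom A B _),
    ((IsLocalization.Away.algebraMap_isUnit b).map u).ne_zero⟩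

theorem generically_exists_aeval_eq {𝕜 ι P : Type*} [Field 𝕜] [Infinite 𝕜] [Finite ι] [Finite P]
    (Ω : Type*) [Field Ω] [IsAlgClosed Ω] [Algebra 𝕜 Ω] (f : ι → MvPolynomial P 𝕜)
    {b : MvPolynomial P 𝕜} (hb : b ≠ 0) :
    Generically (zariskiClosure (Set.range fun (p : P → 𝕜) i => aeval p (f i))) fun x =>
      ∃ p : P → Ω, aeval p b ≠ 0 ∧ ∀ i, aeval p (f i) = algebraMap 𝕜 Ω (x i) := by
  have haeval (p : P → 𝕜) (g : MvPolynomial ι 𝕜) :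
      aeval (fun i => aeval p (f i)) g = aeval p (aeval f g) :=
    (comp_aeval_apply f (aeval p) g).symm
  let := (aeval (R := 𝕜) f).toAlgebra
  have : IsScalarTower 𝕜 (MvPolynomial ι 𝕜) (MvPolynomial P 𝕜) :=
    .of_algebraMap_eq fun c => ((aeval f).commutes c).symm
  have : Algebra.FiniteType (MvPolynomial ι 𝕜) (MvPolynomial P 𝕜) :=
    .of_restrictScalars_finiteType 𝕜 _ _
  obtain ⟨a, ha, H⟩ := exists_forall_algHom_apply_ne_zero (A := MvPolynomial ι 𝕜) hb
  have hSa : ∃ x ∈ Set.range fun (p : P → 𝕜) i => aeval p (f i), aeval x a ≠ 0 := by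
    by_contra! h0
    refine ha (MvPolynomial.funext fun p => ?_)
    exact (haeval p a).symm.trans ((h0 _ ⟨p, rfl⟩).trans (map_zero _).symm)
  refine (generically_aeval_ne_zero hSa).mono fun x hx hxa => ?_
  let := (aeval (R := 𝕜) (algebraMap 𝕜 Ω ∘ x)).toAlgebra
  have hx' (g : MvPolynomial ι 𝕜) :
      algebraMap (MvPolynomial ι 𝕜) Ω g = algebraMap 𝕜 Ω (aeval x g) :=
    aeval_algebraMap_apply Ω x g
  have : IsScalarTower 𝕜 (MvPolynomial ι 𝕜) Ω :=
    .of_algebraMap_eq fun c => ((aeval _).commutes c).symm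
  have hker : RingHom.ker (algebraMap (MvPolynomial ι 𝕜) (MvPolynomial P 𝕜)) ≤
      RingHom.ker (algebraMap (MvPolynomial ι 𝕜) Ω) := by
    intro g (hg : aeval f g = 0)
    rw [RingHom.mem_ker, hx', hx g, map_zero]
    rintro _ ⟨p, rfl⟩
    rw [haeval, hg, map_zero]
  obtain ⟨u, hu⟩ := H Ω hker (hx' a ▸ (map_ne_zero _).2 hxa)
  have huX (g : MvPolynomial P 𝕜) : u g = aeval (fun q => u (X q)) g :=
    DFunLike.congr_fun (aeval_unique (u.restrictScalars 𝕜)) g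
  have hualg (g : MvPolynomial ι 𝕜) : u (aeval f g) = algebraMap 𝕜 Ω (aeval x g) :=
    (u.commutes g).trans (hx' g)
  refine ⟨fun q => u (X q), huX b ▸ hu, fun i => ?_⟩
  rw [← huX, ← aeval_X (R := 𝕜) f i, hualg, aeval_X]

end GenericLift

section Kruskal

open Finset Module Matrix

variable {F : Type*} [Field F] {ι V : Type*} [AddCommGroup V] [Module F V]

/-- Any `k` members of the family `v` are linearly independent, that is, `v` has Kruskal rank at
least `k`; if `v` has fewer than `k` members, all of them are independent. -/
def HasKRank (F : Type*) [Field F] {ι V : Type*} [AddCommGroup V] [Module F V] (k : ℕ)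
    (v : ι → V) : Prop :=
  ∀ s : Finset ι, #s ≤ k → LinearIndepOn F v (s : Set ι)

namespace HasKRank

variable {k : ℕ} {c : ι → V}

theorem ne_zero (hc : HasKRank F k c) (hk : 1 ≤ k) (i : ι) : c i ≠ 0 :=
  (hc {i} (by simpa using hk)).ne_zero (by simp)

theorem mono {l : ℕ} (hc : HasKRank F k c) (hl : l ≤ k) : HasKRank F l c :=
  fun s hs => hc s (hs.trans hl)

theorem min_card_le_finrank_span (hc : HasKRank F k c) (s : Finset ι) :
    min #s k ≤ finrank F (Submodule.span F (c '' s)) := by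
  obtain ⟨t, hts, ht⟩ := exists_subset_card_eq (s := s) (n := min #s k) (min_le_left _ _)
  have : FiniteDimensional F (Submodule.span F (c '' s)) :=
    FiniteDimensional.span_of_finite F (s.finite_toSet.image c)
  have hli : LinearIndependent F fun i : t => c i := hc t (ht.trans_le (min_le_right _ _))
  calc min #s k = finrank F (Submodule.span F (Set.range fun i : t => c i)) := by
        rw [finrank_span_eq_card hli, Fintype.card_coe, ht]
    _ ≤ _ := Submodule.finrank_mono <| Submodule.span_mono <|
        Set.range_subset_iff.2 fun i => Set.mem_image_of_mem c (hts i.2)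

theorem mem_of_mem_span_image (hc : HasKRank F k c) {s : Finset ι} (hs : #s < k) {j : ι}
    (hj : c j ∈ Submodule.span F (c '' s)) : j ∈ s := by
  classical
  by_contra hjs
  have hli := hc (insert j s) ((card_insert_of_notMem hjs).trans_le hs)
  rw [coe_insert] at hli
  exact hli.notMem_span_of_insert (mod_cast hjs) hj

theorem eq_of_mem_span_singleton (hc : HasKRank F 2 c) {v : V} {i j : ι}
    (hi : c i ∈ Submodule.span F {v}) (hj : c j ∈ Submodule.span F {v}) : i = j := by
  classical
  by_contra hij
  have hle : Submodule.span F (c '' ({i, j} : Finset ι)) ≤ Submodule.span F {v} := by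
    simp [Submodule.span_le, Set.insert_subset_iff, Set.image_pair, hi, hj]
  have h₁ := hc.min_card_le_finrank_span {i, j}
  have h₂ := (Submodule.finrank_mono hle).trans (finrank_span_le_card ({v} : Set V))
  simp only [card_pair hij, min_self, Set.toFinset_singleton, card_singleton] at h₁ h₂
  omega

open scoped Classical in
theorem exists_dual [Fintype ι] (hc : HasKRank F k c) (hk : 2 ≤ k) {i j : ι} (hij : i ≠ j) :
    ∃ x : Dual F V, x (c i) ≠ 0 ∧ x (c j) = 0 ∧
      min k (Fintype.card ι) ≤ #{l | x (c l) = 0} + 1 := by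
  have hcard : 1 < Fintype.card ι := Fintype.one_lt_card_iff.2 ⟨i, j, hij⟩
  obtain ⟨Q, hjQ, hQi, hQ⟩ := exists_subsuperset_card_eq (s := {j}) (t := univ.erase i)
    (n := min k (Fintype.card ι) - 1) (by simpa using hij.symm) (by simp; omega)
    (by rw [card_erase_of_mem (mem_univ _), card_univ]; omega)
  have hiQ : c i ∉ Submodule.span F (c '' Q) := fun h => by
    simpa using hQi (hc.mem_of_mem_span_image (by omega) h)
  obtain ⟨x, hx, hle⟩ := Submodule.exists_le_ker_of_notMem hiQ
  have hxQ : ∀ l ∈ Q, x (c l) = 0 := fun l hl => hle (Submodule.subset_span ⟨l, hl, rfl⟩)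
  have hQx : #Q ≤ #{l | x (c l) = 0} := card_le_card fun l hl => by simpa using hxQ l hl
  exact ⟨x, hx, hxQ j (hjQ (mem_singleton_self j)), by omega⟩

end HasKRank

theorem span_singleton_sup_eq_of_mem {W : Submodule F V} {u v : V}
    (hv : v ∈ Submodule.span F {u} ⊔ W) (hvW : v ∉ W) :
    Submodule.span F {v} ⊔ W = Submodule.span F {u} ⊔ W := by
  refine ((Submodule.wcovBy_span_singleton_sup u W).eq_or_eq le_sup_right
    (sup_le ((Submodule.span_singleton_le_iff_mem _ _).2 hv) le_sup_right)).resolve_left ?_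
  exact fun h => hvW (h ▸ Submodule.mem_sup_left (Submodule.mem_span_singleton_self v))

theorem exists_dual_eq_zero_iff_mem {W : Submodule F V} {v : V} (hv : v ∉ W) :
    ∃ x : Dual F V, ∀ u ∈ Submodule.span F {v} ⊔ W, x u = 0 ↔ u ∈ W := by
  obtain ⟨x, hx, hle⟩ := Submodule.exists_le_ker_of_notMem hv
  refine ⟨x, fun u hu => ⟨fun hxu => ?_, fun h => hle h⟩⟩
  by_contra huW
  have hker : Submodule.span F {u} ⊔ W ≤ LinearMap.ker x :=
    sup_le ((Submodule.span_singleton_le_iff_mem _ _).2 hxu) hle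
  rw [span_singleton_sup_eq_of_mem hu huW] at hker
  exact hx (hker (Submodule.mem_sup_left (Submodule.mem_span_singleton_self v)))

section Flats

variable [Fintype ι] {c c' : ι → V} {k : ℕ}

open scoped Classical in
theorem card_mem_span_singleton_sup (c : ι → V) (W : Submodule F V) (u : V) :
    #{i | c i ∈ Submodule.span F {u} ⊔ W} = #{i | c i ∈ W} +
      #{i ∈ ({i | c i ∉ W} : Finset ι) |
        Submodule.span F {c i} ⊔ W = Submodule.span F {u} ⊔ W} := by
  rw [← card_filter_add_card_filter_not (s := {i | c i ∈ Submodule.span F {u} ⊔ W})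
    fun i => c i ∈ W, filter_filter, filter_filter, filter_filter]
  congr 2 <;> ext i <;> simp only [mem_filter, mem_univ, true_and]
  · exact ⟨And.right, fun h => ⟨Submodule.mem_sup_right h, h⟩⟩
  · refine ⟨fun h => ⟨h.2, span_singleton_sup_eq_of_mem h.1 h.2⟩, fun h => ⟨?_, h.1⟩⟩
    exact h.2 ▸ Submodule.mem_sup_left (Submodule.mem_span_singleton_self _)

open scoped Classical in
theorem finrank_span_image_le_card_mem (c : ι → V) (Q : Finset ι) :
    finrank F (Submodule.span F (c '' Q)) ≤ #{i | c i ∈ Submodule.span F (c '' Q)} := by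
  rw [← coe_image]
  refine (finrank_span_finset_le_card (R := F) (Q.image c)).trans (card_image_le.trans ?_)
  exact card_le_card fun i hi => by
    simpa using Submodule.subset_span (Set.mem_image_of_mem c hi)

open scoped Classical in
/-- The lines of `V ⧸ W` spanned by the `c' j` are disjoint outside `W`. Summing over `m ≥ 2` of
them turns the hypotheses into `m * #{c' ∈ W} + #{c' ∉ W} ≤ m * #{c ∈ W} + #{c ∉ W}`. -/
theorem card_mem_le_of_forall_card_mem_sup_le {W : Submodule F V}
    (h : ∀ j, c' j ∉ W → #{i | c' i ∈ Submodule.span F {c' j} ⊔ W} ≤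
      #{i | c i ∈ Submodule.span F {c' j} ⊔ W})
    {j₀ j₁ : ι} (hj₀ : c' j₀ ∉ W) (hj₁ : c' j₁ ∉ Submodule.span F {c' j₀} ⊔ W) :
    #{i | c' i ∈ W} ≤ #{i | c i ∈ W} := by
  let line : V → Submodule F V := fun v => Submodule.span F {v} ⊔ W
  let lines : Finset (Submodule F V) := ({j | c' j ∉ W} : Finset ι).image fun j => line (c' j)
  have hmem : ∀ j, c' j ∉ W → line (c' j) ∈ lines := fun j hj =>
    mem_image_of_mem _ (by simpa using hj)
  have two_le : 2 ≤ #lines := by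
    refine one_lt_card.2 ⟨_, hmem j₀ hj₀, _,
      hmem j₁ fun h => hj₁ (Submodule.mem_sup_right h), fun h => hj₁ ?_⟩
    change c' j₁ ∈ line (c' j₀)
    exact h ▸ Submodule.mem_sup_left (Submodule.mem_span_singleton_self _)
  have hsplit : ∀ u : ι → V, ∑ X ∈ lines, #{i | u i ∈ X} = #lines * #{i | u i ∈ W} +
      ∑ X ∈ lines, #{i ∈ ({i | u i ∉ W} : Finset ι) | line (u i) = X} := by
    intro u
    rw [← smul_eq_mul, ← sum_const, ← sum_add_distrib]
    refine sum_congr rfl fun X hX => ?_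
    obtain ⟨j, -, rfl⟩ := mem_image.1 hX
    exact card_mem_span_singleton_sup u W (c' j)
  have hsum : ∑ X ∈ lines, #{i | c' i ∈ X} ≤ ∑ X ∈ lines, #{i | c i ∈ X} := by
    refine sum_le_sum fun X hX => ?_
    obtain ⟨j, hj, rfl⟩ := mem_image.1 hX
    exact h j (by simpa using hj)
  rw [hsplit, hsplit, ← card_eq_sum_card_image, sum_card_fiberwise_eq_card_filter] at hsum
  have hout : #{i ∈ ({i | c i ∉ W} : Finset ι) | line (c i) ∈ lines} ≤ #{i | c i ∉ W} :=
    card_filter_le _ _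
  have hc : #{i | c i ∈ W} + #{i | c i ∉ W} = Fintype.card ι :=
    card_filter_add_card_filter_not _
  have hc' : #{i | c' i ∈ W} + #{i | c' i ∉ W} = Fintype.card ι :=
    card_filter_add_card_filter_not _
  by_contra! hlt
  nlinarith

open scoped Classical in
theorem mem_span_range_of_forall_dual
    (h : ∀ x : Dual F V, (∀ i, x (c' i) = 0) → #{i | x (c' i) = 0} ≤ #{i | x (c i) = 0}) (j : ι) :
    c j ∈ Submodule.span F (Set.range c') := by
  by_contra hj
  obtain ⟨x, hx, hle⟩ := Submodule.exists_le_ker_of_notMem hj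
  have h0 : ∀ i, x (c' i) = 0 := fun i => hle (Submodule.subset_span ⟨i, rfl⟩)
  have hcard := h x h0
  rw [filter_true_of_mem fun i _ => h0 i] at hcard
  have := eq_of_subset_of_card_le (filter_subset _ _) hcard
  exact hx (filter_eq_self.1 this j (mem_univ j))

variable [FiniteDimensional F V]

open scoped Classical in
theorem HasKRank.card_mem_span_image_le_of_forall_mem_sup (hc : HasKRank F k c)
    (h : ∀ x : Dual F V, min k (Fintype.card ι) ≤ #{i | x (c' i) = 0} + 1 →
      #{i | x (c' i) = 0} ≤ #{i | x (c i) = 0})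
    {Q : Finset ι} {v : V} (hv : v ∉ Submodule.span F (c' '' Q))
    (hmem : ∀ i, c i ∈ Submodule.span F {v} ⊔ Submodule.span F (c' '' Q))
    (hmem' : ∀ i, c' i ∈ Submodule.span F {v} ⊔ Submodule.span F (c' '' Q)) :
    #{i | c' i ∈ Submodule.span F (c' '' Q)} ≤ #{i | c i ∈ Submodule.span F (c' '' Q)} := by
  obtain ⟨x, hx⟩ := exists_dual_eq_zero_iff_mem hv
  have hrank : min k (Fintype.card ι) ≤ #{i | c' i ∈ Submodule.span F (c' '' Q)} + 1 := calc
    min k (Fintype.card ι) ≤ finrank F (Submodule.span F (Set.range c)) := by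
      rw [min_comm, ← Set.image_univ, ← coe_univ, ← card_univ]
      exact hc.min_card_le_finrank_span univ
    _ ≤ finrank F (Submodule.span F {v} ⊔ Submodule.span F (c' '' Q) : Submodule F V) :=
      Submodule.finrank_mono (Submodule.span_le.2 (Set.range_subset_iff.2 hmem))
    _ ≤ finrank F (Submodule.span F {v}) + finrank F (Submodule.span F (c' '' Q)) :=
      Submodule.finrank_add_le_finrank_add_finrank _ _
    _ ≤ 1 + #{i | c' i ∈ Submodule.span F (c' '' Q)} :=
      add_le_add ((finrank_span_le_card ({v} : Set V)).trans (by simp))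
        (finrank_span_image_le_card_mem c' Q)
    _ = _ := add_comm _ _
  simp only [← hx _ (hmem _), ← hx _ (hmem' _)] at hrank ⊢
  exact h x hrank

open scoped Classical in
theorem HasKRank.card_mem_span_image_le (hc : HasKRank F k c)
    (h : ∀ x : Dual F V, min k (Fintype.card ι) ≤ #{i | x (c' i) = 0} + 1 →
      #{i | x (c' i) = 0} ≤ #{i | x (c i) = 0}) (Q : Finset ι) :
    #{i | c' i ∈ Submodule.span F (c' '' Q)} ≤ #{i | c i ∈ Submodule.span F (c' '' Q)} := by
  have hspan : ∀ j, c j ∈ Submodule.span F (Set.range c') :=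
    mem_span_range_of_forall_dual fun x hx => h x (by simp [hx])
  induction hW : Submodule.span F (c' '' Q) using WellFoundedGT.induction generalizing Q with
  | ind W ih =>
  by_cases hall : ∀ i, c' i ∈ W
  · have : ∀ i, c i ∈ W := fun i => Submodule.span_le.2 (Set.range_subset_iff.2 hall) (hspan i)
    simp [hall, this]
  push Not at hall
  obtain ⟨j₀, hj₀⟩ := hall
  by_cases hall₀ : ∀ i, c' i ∈ Submodule.span F {c' j₀} ⊔ W
  · subst hW
    exact hc.card_mem_span_image_le_of_forall_mem_sup h hj₀
      (fun i => Submodule.span_le.2 (Set.range_subset_iff.2 hall₀) (hspan i)) hall₀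
  push Not at hall₀
  obtain ⟨j₁, hj₁⟩ := hall₀
  refine card_mem_le_of_forall_card_mem_sup_le (fun j hj => ?_) hj₀ hj₁
  refine ih _ (Submodule.covBy_span_singleton_sup hj).1 (insert j Q) ?_
  rw [coe_insert, Set.image_insert_eq, Submodule.span_insert, hW]

end Flats

open scoped Classical in
theorem HasKRank.exists_perm_smul_eq [Fintype ι] {c c' : ι → V} (hc : HasKRank F 2 c)
    (h : ∀ j, #{i | c' i ∈ Submodule.span F {c' j}} ≤ #{i | c i ∈ Submodule.span F {c' j}}) :
    ∃ (σ : Equiv.Perm ι) (l : ι → F), ∀ i, c' i = l i • c (σ i) := by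
  have hmem : ∀ j, ∃ i, c i ∈ Submodule.span F {c' j} := fun j => by
    have hpos : 0 < #{i | c' i ∈ Submodule.span F {c' j}} :=
      card_pos.2 ⟨j, by simp [Submodule.mem_span_singleton_self]⟩
    obtain ⟨i, hi⟩ := card_pos.1 (hpos.trans_le (h j))
    exact ⟨i, by simpa using hi⟩
  choose f hf using hmem
  have hsmul : ∀ j, ∃ l : F, c' j = l • c (f j) := fun j => by
    obtain ⟨r, hr⟩ := Submodule.mem_span_singleton.1 (hf j)
    have hr0 : r ≠ 0 := by
      rintro rfl
      exact hc.ne_zero one_le_two (f j) (by rw [← hr, zero_smul])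
    exact ⟨r⁻¹, by rw [← hr, inv_smul_smul₀ hr0]⟩
  choose l hl using hsmul
  have hinj : Function.Injective f := fun i j hij => by
    have hle : #{i | c i ∈ Submodule.span F {c' j}} ≤ 1 :=
      card_le_one.2 fun a ha b hb => hc.eq_of_mem_span_singleton (v := c' j)
        (by simpa using ha) (by simpa using hb)
    refine card_le_one.1 ((h j).trans hle) i ?_ j ?_
    · simpa [hl i, hij] using Submodule.smul_mem _ _ (hf j)
    · simp [Submodule.mem_span_singleton_self]
  exact ⟨Equiv.ofBijective f (Finite.injective_iff_bijective.1 hinj), l, hl⟩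

open scoped Classical in
/-- Kruskal's permutation lemma. -/
theorem HasKRank.exists_perm_smul_eq_of_forall_dual [Fintype ι] [FiniteDimensional F V] {k : ℕ}
    {c c' : ι → V} (hc : HasKRank F k c) (hk : 2 ≤ k)
    (h : ∀ x : Dual F V, min k (Fintype.card ι) ≤ #{i | x (c' i) = 0} + 1 →
      #{i | x (c' i) = 0} ≤ #{i | x (c i) = 0}) :
    ∃ (σ : Equiv.Perm ι) (l : ι → F), ∀ i, c' i = l i • c (σ i) :=
  (hc.mono hk).exists_perm_smul_eq fun j => by simpa using hc.card_mem_span_image_le h {j}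

theorem finrank_map_add_finrank_le {W : Type*} [AddCommGroup W] [Module F W]
    [FiniteDimensional F V] (f : V →ₗ[F] W) {p q : Submodule F V} (h : p ≤ q) :
    finrank F (q.map f) + finrank F p ≤ finrank F q + finrank F (p.map f) := by
  have hsplit : ∀ r : Submodule F V,
      finrank F (r.map f) + finrank F (LinearMap.ker f ⊓ r : Submodule F V) = finrank F r := by
    intro r
    rw [← (f.domRestrict r).finrank_range_add_finrank_ker, LinearMap.range_domRestrict,
      LinearMap.ker_domRestrict, ← Submodule.finrank_map_subtype_eq, Submodule.map_comap_subtype,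
      inf_comm]
  have hker : finrank F (LinearMap.ker f ⊓ p : Submodule F V) ≤
      finrank F (LinearMap.ker f ⊓ q : Submodule F V) :=
    Submodule.finrank_mono (inf_le_inf_left _ h)
  have hp := hsplit p
  have hq := hsplit q
  omega

/-- Frobenius' rank inequality. -/
theorem rank_mul_add_rank_mul_le {X I J Y : Type*} [Fintype I] [Fintype J] [Fintype Y]
    (A : Matrix X I F) (D : Matrix I J F) (B : Matrix J Y F) :
    (A * D).rank + (D * B).rank ≤ D.rank + (A * D * B).rank := by
  have hle : LinearMap.range (D * B).mulVecLin ≤ LinearMap.range D.mulVecLin := by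
    rw [mulVecLin_mul]
    exact LinearMap.range_comp_le_range _ _
  have hmap := finrank_map_add_finrank_le A.mulVecLin hle
  rwa [← LinearMap.range_comp, ← LinearMap.range_comp, ← mulVecLin_mul, ← mulVecLin_mul,
    ← Matrix.mul_assoc] at hmap

section ThirdOrder

variable [Fintype ι] {X Y Z : Type*}

open scoped Classical in
theorem HasKRank.min_card_le_rank [DecidableEq ι] [Finite X] {k : ℕ} {A : Matrix ι X F}
    (hA : HasKRank F k A.row) (d : ι → F) : min #{i | d i ≠ 0} k ≤ (Aᵀ * diagonal d).rank := by
  have := Fintype.ofFinite X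
  rw [rank_eq_finrank_span_cols]
  refine (hA.min_card_le_finrank_span _).trans (Submodule.finrank_mono (Submodule.span_le.2 ?_))
  rintro _ ⟨i, hi, rfl⟩
  have hdi : d i ≠ 0 := by simpa using hi
  have hcol : A.row i = (d i)⁻¹ • (Aᵀ * diagonal d).col i := by
    ext x
    simp [mul_diagonal, hdi, mul_comm]
  rw [hcol]
  exact Submodule.smul_mem _ _ (Submodule.subset_span ⟨i, rfl⟩)

variable {A A' : Matrix ι X F} {B B' : Matrix ι Y F} {C C' : Matrix ι Z F} {kA kB kC : ℕ}
  {d d' : ι → F}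

open scoped Classical in
theorem HasKRank.min_add_min_le [DecidableEq ι] [Finite X] [Finite Y] (hA : HasKRank F kA A.row)
    (hB : HasKRank F kB B.row) (h : Aᵀ * diagonal d * B = A'ᵀ * diagonal d' * B') :
    min #{i | d i ≠ 0} kA + min #{i | d i ≠ 0} kB ≤ #{i | d i ≠ 0} + #{i | d' i ≠ 0} := by
  have := Fintype.ofFinite X
  have := Fintype.ofFinite Y
  have rank_diag : ∀ e : ι → F, (diagonal e).rank = #{i | e i ≠ 0} := fun e => by
    rw [Matrix.rank_diagonal, Fintype.card_subtype]
  calc min #{i | d i ≠ 0} kA + min #{i | d i ≠ 0} kB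
      ≤ (Aᵀ * diagonal d).rank + (Bᵀ * diagonal d).rank :=
        add_le_add (hA.min_card_le_rank d) (hB.min_card_le_rank d)
    _ = (Aᵀ * diagonal d).rank + (diagonal d * B).rank := by
        rw [← rank_transpose (diagonal d * B), transpose_mul, diagonal_transpose]
    _ ≤ (diagonal d).rank + (Aᵀ * diagonal d * B).rank := rank_mul_add_rank_mul_le _ _ _
    _ ≤ #{i | d i ≠ 0} + #{i | d' i ≠ 0} := by
        rw [h, rank_diag, ← rank_diag d']
        gcongr
        exact (rank_mul_le_left _ _).trans (rank_mul_le_right _ _)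

open scoped Classical in
theorem HasKRank.card_eq_zero_le [DecidableEq ι] [Finite X] [Finite Y] (hA : HasKRank F kA A.row)
    (hB : HasKRank F kB B.row) (h : Aᵀ * diagonal d * B = A'ᵀ * diagonal d' * B')
    (hk : 2 * Fintype.card ι + 2 ≤
      min kA (Fintype.card ι) + min kB (Fintype.card ι) + min kC (Fintype.card ι))
    (hd' : min kC (Fintype.card ι) ≤ #{i | d' i = 0} + 1) :
    #{i | d' i = 0} ≤ #{i | d i = 0} := by
  have hle := hA.min_add_min_le hB h
  have hd : #{i | d i = 0} + #{i | d i ≠ 0} = Fintype.card ι := card_filter_add_card_filter_not _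
  have hd'' : #{i | d' i = 0} + #{i | d' i ≠ 0} = Fintype.card ι :=
    card_filter_add_card_filter_not _
  omega

theorem transpose_mul_diagonal_mul_apply [DecidableEq ι] (A : Matrix ι X F) (d : ι → F)
    (B : Matrix ι Y F) (x : X) (y : Y) :
    (Aᵀ * diagonal d * B) x y = ∑ i, A i x * d i * B i y := by
  rw [mul_apply]
  simp only [mul_diagonal, transpose_apply]

theorem transpose_mul_diagonal_mul_eq_of_sum_eq [DecidableEq ι]
    (h : ∀ x y z, ∑ i, A i x * B i y * C i z = ∑ i, A' i x * B' i y * C' i z)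
    (f : Dual F (Z → F)) :
    Aᵀ * diagonal (fun i => f (C i)) * B = A'ᵀ * diagonal (fun i => f (C' i)) * B' := by
  ext x y
  have hxy : ∑ i, (A i x * B i y) • C i = ∑ i, (A' i x * B' i y) • C' i := by
    ext z
    simpa using h x y z
  simpa [transpose_mul_diagonal_mul_apply, mul_right_comm] using congrArg f hxy

theorem mem_span_image_support_of_linearIndepOn [DecidableEq ι]
    (h : Aᵀ * diagonal d * B = A'ᵀ * diagonal d' * B')
    (hB : LinearIndepOn F B.row (Function.support d)) {j : ι} (hj : d j ≠ 0) :
    A.row j ∈ Submodule.span F (A'.row '' Function.support d') := by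
  obtain ⟨f, hf, hle⟩ := Submodule.exists_le_ker_of_notMem (hB.notMem_span hj)
  have hf0 : ∀ i, i ≠ j → d i * f (B.row i) = 0 := fun i hij => by
    by_cases hi : d i = 0
    · rw [hi, zero_mul]
    · rw [show f (B.row i) = 0 from hle (Submodule.subset_span ⟨i, ⟨hi, hij⟩, rfl⟩), mul_zero]
  have key : (d j * f (B.row j)) • A.row j = ∑ i, (d' i * f (B'.row i)) • A'.row i := by
    ext x
    have hx : ∑ i, (A i x * d i) • B.row i = ∑ i, (A' i x * d' i) • B'.row i := by
      ext y
      simpa [transpose_mul_diagonal_mul_apply] using congrFun₂ h x y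
    have hfx := congrArg f hx
    simp only [map_sum, map_smul, smul_eq_mul, mul_assoc] at hfx
    rw [sum_eq_single j (fun i _ hij => by rw [hf0 i hij, mul_zero]) (by simp)] at hfx
    simpa [mul_comm, mul_left_comm] using hfx
  rw [← inv_smul_smul₀ (mul_ne_zero hj hf) (A.row j), key]
  refine Submodule.smul_mem _ _ (Submodule.sum_mem _ fun i _ => ?_)
  by_cases hi : d' i = 0
  · simp [hi]
  · exact Submodule.smul_mem _ _ (Submodule.subset_span ⟨i, hi, rfl⟩)

open scoped Classical in
theorem HasKRank.apply_perm_ne_zero [DecidableEq ι] (hA : HasKRank F kA A.row)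
    (hB : HasKRank F kB B.row) {σ : Equiv.Perm ι}
    (h : Aᵀ * diagonal d * B = (A.submatrix σ id)ᵀ * diagonal d * B')
    (hdA : #{i | d i ≠ 0} < kA) (hdB : #{i | d i ≠ 0} ≤ kB) {j : ι} (hj : d j ≠ 0) :
    d (σ j) ≠ 0 := by
  let S : Finset ι := {i | d i ≠ 0}
  have hS : (S : Set ι) = Function.support d := by ext; simp [S]
  have hsub : S ⊆ S.image σ := fun i hi => by
    refine hA.mem_of_mem_span_image (card_image_le.trans_lt hdA) ?_
    have := mem_span_image_support_of_linearIndepOn h (hS ▸ hB S hdB) (by simpa [S] using hi)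
    rw [coe_image, ← Set.image_comp, hS]
    exact this
  have hσj : σ j ∈ S := by
    rw [eq_of_subset_of_card_le hsub card_image_le]
    exact mem_image_of_mem _ (by simpa [S] using hj)
  simpa [S] using hσj

theorem HasKRank.exists_perm_smul_eq_of_sum_eq [Finite X] [Finite Y] [Finite Z]
    (hA : HasKRank F kA A.row) (hB : HasKRank F kB B.row) (hC : HasKRank F kC C.row)
    (hk : 2 * Fintype.card ι + 2 ≤
      min kA (Fintype.card ι) + min kB (Fintype.card ι) + min kC (Fintype.card ι))
    (h : ∀ x y z, ∑ i, A i x * B i y * C i z = ∑ i, A' i x * B' i y * C' i z) :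
    ∃ (σ : Equiv.Perm ι) (l : ι → F), ∀ i, C'.row i = l i • C.row (σ i) := by
  classical
  refine hC.exists_perm_smul_eq_of_forall_dual (by omega) fun f hf => ?_
  exact hA.card_eq_zero_le hB (transpose_mul_diagonal_mul_eq_of_sum_eq h f) hk hf

theorem HasKRank.eq_one_of_sum_eq
    (hA : HasKRank F kA A.row) (hB : HasKRank F kB B.row) (hC : HasKRank F kC C.row)
    (hk : 2 * Fintype.card ι + 2 ≤
      min kA (Fintype.card ι) + min kB (Fintype.card ι) + min kC (Fintype.card ι))
    {σ : Equiv.Perm ι}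
    (h : ∀ x y z, ∑ i, A i x * B i y * C i z = ∑ i, A (σ i) x * B' i y * C i z) : σ = 1 := by
  classical
  ext i
  by_contra hne
  obtain ⟨f, hfi, hfσ, hf⟩ := hC.exists_dual (by omega) (Ne.symm hne)
  replace hf : min kC (Fintype.card ι) ≤ #{i | f (C i) = 0} + 1 := hf
  have hcard : #{i | f (C i) = 0} + #{i | f (C i) ≠ 0} = Fintype.card ι :=
    card_filter_add_card_filter_not _
  exact hA.apply_perm_ne_zero hB (transpose_mul_diagonal_mul_eq_of_sum_eq h f)
    (by omega) (by omega) hfi hfσ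

theorem HasKRank.eq_of_sum_eq [Finite X] [Finite Y]
    (hA : HasKRank F kA A.row) (hB : HasKRank F kB B.row)
    (hk : 2 * Fintype.card ι + 2 ≤
      min kA (Fintype.card ι) + min kB (Fintype.card ι) + min kC (Fintype.card ι))
    (h : ∀ x y z, ∑ i, A i x * B i y * C i z = ∑ i, A i x * B i y * C' i z) : C = C' := by
  classical
  ext i z
  have hz : Aᵀ * diagonal (fun i => C i z - C' i z) * B = Aᵀ * diagonal (0 : ι → F) * B := by
    ext x y
    simpa [transpose_mul_diagonal_mul_apply, mul_sub, sub_mul, sub_eq_zero, mul_right_comm]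
      using h x y z
  have hcard : #(univ : Finset ι) ≤ #{i | C i z - C' i z = 0} := by
    simpa only [Pi.zero_apply, filter_true] using hA.card_eq_zero_le (kC := kC) hB hz hk (by simp)
  have hall := card_filter_eq_iff.1 ((card_filter_le _ _).antisymm hcard)
  exact sub_eq_zero.1 (hall i (mem_univ i))

/-- **Kruskal's theorem** on the uniqueness of decompositions of third-order tensors. -/
theorem kruskal [Finite X] [Finite Y] [Finite Z]
    (hA : HasKRank F kA A.row) (hB : HasKRank F kB B.row) (hC : HasKRank F kC C.row)
    (hk : 2 * Fintype.card ι + 2 ≤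
      min kA (Fintype.card ι) + min kB (Fintype.card ι) + min kC (Fintype.card ι))
    (h : ∀ x y z, ∑ i, A i x * B i y * C i z = ∑ i, A' i x * B' i y * C' i z) :
    ∃ σ : Equiv.Perm ι, ∀ i x y z,
      A' i x * B' i y * C' i z = A (σ i) x * B (σ i) y * C (σ i) z := by
  have hrot : ∀ y z x, ∑ i, B i y * C i z * A i x = ∑ i, B' i y * C' i z * A' i x := by
    intro y z x
    simpa only [mul_comm, mul_left_comm] using h x y z
  obtain ⟨σ, l, hσ⟩ := hA.exists_perm_smul_eq_of_sum_eq hB hC hk h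
  obtain ⟨τ, m, hτ⟩ := hB.exists_perm_smul_eq_of_sum_eq hC hA (by omega) hrot
  let B'' : Matrix ι Y F := fun i => (m (σ⁻¹ i) * l (σ⁻¹ i)) • B' (σ⁻¹ i)
  have hreindex : ∀ x y z, ∑ i, A i x * B i y * C i z =
      ∑ i, A ((τ * σ⁻¹) i) x * B'' i y * C i z := by
    intro x y z
    rw [h, ← Equiv.sum_comp σ fun i => A ((τ * σ⁻¹) i) x * B'' i y * C i z]
    refine sum_congr rfl fun i _ => ?_
    have hCi : C' i z = l i * C (σ i) z := congrFun (hσ i) z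
    have hAi : A' i x = m i * A (τ i) x := congrFun (hτ i) x
    simp only [B'', hAi, hCi, Equiv.Perm.mul_apply, Equiv.Perm.inv_def, Equiv.symm_apply_apply,
      Pi.smul_apply, smul_eq_mul]
    ring
  have hτσ : τ = σ := mul_inv_eq_one.1 (hA.eq_one_of_sum_eq hB hC hk hreindex)
  have hB'' : B = B'' := hA.eq_of_sum_eq hC (kC := kB) (by omega) fun x z y => by
    simpa [hτσ, mul_right_comm] using hreindex x y z
  refine ⟨σ, fun i x y z => ?_⟩
  have hCi : C' i z = l i * C (σ i) z := congrFun (hσ i) z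
  have hAi : A' i x = m i * A (σ i) x := by rw [← hτσ]; exact congrFun (hτ i) x
  have hBi : B (σ i) y = m i * l i * B' i y := by simp [hB'', B'']
  rw [hAi, hCi, hBi]
  ring

end ThirdOrder

end Kruskal

section Decomposition

open Finset

variable {F : Type*} [Field F] {d : ℕ} {n : Fin d → ℕ} {ι : Type*} [Fintype ι]

theorem exists_map_univ_eq {α : Type*} (M : Multiset α)
    (hM : Multiset.card M = Fintype.card ι) : ∃ u : ι → α, univ.val.map u = M := by
  classical
  let e : ι ≃ M := Fintype.equivOfCardEq (by rw [Multiset.card_coe, hM])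
  refine ⟨(fun x : M => (x : α)) ∘ e, ?_⟩
  rw [← Multiset.map_map, Multiset.map_univ_val_equiv, Multiset.map_univ_coe]

theorem outer_zero (hd : 0 < d) : outer (0 : ∀ j : Fin d, Fin (n j) → F) = 0 := by
  ext t
  exact prod_eq_zero (mem_univ ⟨0, hd⟩) rfl

theorem exists_map_outer_eq_add_replicate (hd : 0 < d) {s : ℕ} {T : Tensor F n}
    {A : Sym (Tensor F n) s} (hA : A ∈ decompositions s T) (hs : s ≤ Fintype.card ι) :
    ∃ a : ι → ∀ j : Fin d, Fin (n j) → F, ∑ i, outer (a i) = T ∧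
      univ.val.map (fun i => outer (a i)) =
        (A : Multiset (Tensor F n)) + Multiset.replicate (Fintype.card ι - s) 0 := by
  obtain ⟨u, hu⟩ := exists_map_univ_eq (ι := ι)
    ((A : Multiset (Tensor F n)) + Multiset.replicate (Fintype.card ι - s) 0) (by
      rw [Multiset.card_add, Multiset.card_replicate, Sym.card_coe, Nat.add_sub_cancel' hs])
  have houter (i : ι) : ∃ a : ∀ j : Fin d, Fin (n j) → F, outer a = u i := by
    have hi : u i ∈ univ.val.map u := Multiset.mem_map_of_mem u (mem_univ i)
    rcases Multiset.mem_add.1 (hu ▸ hi) with h | h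
    · obtain ⟨-, a, ha⟩ := hA.1 _ h
      exact ⟨a, ha.symm⟩
    · exact ⟨0, by rw [outer_zero hd, Multiset.eq_of_mem_replicate h]⟩
  choose a ha using houter
  refine ⟨a, ?_, by simp only [ha, hu]⟩
  calc ∑ i, outer (a i) = (univ.val.map u).sum := by simp only [ha]; rfl
    _ = T := by
      rw [hu, Multiset.sum_add, hA.2, Multiset.sum_replicate, smul_zero, add_zero]

theorem tensorRank_sum_outer_le (a : ι → ∀ j : Fin d, Fin (n j) → F) :
    tensorRank (∑ i, outer (a i)) ≤ Fintype.card ι := by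
  classical
  let s : Finset ι := {i | outer (a i) ≠ 0}
  let M : Multiset (Tensor F n) := s.val.map fun i => outer (a i)
  have hM : Multiset.card M ≤ Fintype.card ι := by
    rw [Multiset.card_map]
    exact s.card_le_univ
  refine le_trans (Nat.sInf_le ⟨⟨M, rfl⟩, fun B hB => ?_, sum_filter_ne_zero univ⟩) hM
  obtain ⟨i, hi, rfl⟩ := Multiset.mem_map.1 (show B ∈ M from hB)
  exact ⟨(mem_filter.1 hi).2, a i, rfl⟩

theorem exists_sum_outer_eq (hd : 0 < d) {T : Tensor F n} (hT : tensorRank T ≤ Fintype.card ι) :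
    ∃ a : ι → ∀ j : Fin d, Fin (n j) → F, ∑ i, outer (a i) = T := by
  obtain ⟨A, hA⟩ := Nat.sInf_mem (exists_decomposition hd T)
  obtain ⟨a, ha, -⟩ := exists_map_outer_eq_add_replicate hd hA hT
  exact ⟨a, ha⟩

theorem isIdentifiable_of_forall_exists_perm (hd : 0 < d) {T : Tensor F n}
    {a : ι → ∀ j : Fin d, Fin (n j) → F} (ha : ∑ i, outer (a i) = T) (hne : ∀ i, outer (a i) ≠ 0)
    (huniq : ∀ b : ι → ∀ j : Fin d, Fin (n j) → F, ∑ i, outer (b i) = T →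
      ∃ σ : Equiv.Perm ι, ∀ i, outer (b i) = outer (a (σ i))) :
    IsIdentifiable (Fintype.card ι) T := by
  let A₀ : Sym (Tensor F n) (Fintype.card ι) :=
    ⟨univ.val.map fun i => outer (a i), Multiset.card_map _ _⟩
  have hA₀ : A₀ ∈ decompositions (Fintype.card ι) T := by
    refine ⟨fun B hB => ?_, ha⟩
    obtain ⟨i, -, rfl⟩ := Multiset.mem_map.1 (show B ∈ (A₀ : Multiset (Tensor F n)) from hB)
    exact ⟨hne i, _, rfl⟩
  have h0 : 0 ∉ (A₀ : Multiset (Tensor F n)) := fun h => by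
    obtain ⟨i, -, hi⟩ := Multiset.mem_map.1 h
    exact hne i hi
  have heq {s : ℕ} {A : Sym (Tensor F n) s} (hA : A ∈ decompositions s T)
      (hs : s ≤ Fintype.card ι) :
      (A₀ : Multiset (Tensor F n)) =
        (A : Multiset (Tensor F n)) + Multiset.replicate (Fintype.card ι - s) 0 := by
    obtain ⟨b, hb, hbA⟩ := exists_map_outer_eq_add_replicate hd hA hs
    obtain ⟨σ, hσ⟩ := huniq b hb
    have hbσ : (fun i => outer (b i)) = (fun i => outer (a i)) ∘ σ := funext hσ
    rw [← hbA, hbσ, ← Multiset.map_map, Multiset.map_univ_val_equiv]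
    rfl
  refine ⟨le_antisymm (Nat.sInf_le ⟨A₀, hA₀⟩) (le_csInf ⟨_, A₀, hA₀⟩ fun s ⟨A, hA⟩ => ?_), A₀,
    Set.eq_singleton_iff_unique_mem.2 ⟨hA₀, fun A hA => Sym.coe_injective ?_⟩⟩
  · by_contra! hs
    rw [heq hA hs.le] at h0
    exact h0 (Multiset.mem_add.2 (.inr (Multiset.mem_replicate.2 ⟨by omega, rfl⟩)))
  · rw [heq hA le_rfl, Nat.sub_self, Multiset.replicate_zero, add_zero]

end Decomposition

section Reshaping

open Finset

/-- `I`, `J`, `K` are the blocks, possibly empty, of a partition of the index set. -/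
structure IsTripartition {α : Type*} [Fintype α] [DecidableEq α] (I J K : Finset α) : Prop where
  disjoint_left_mid : Disjoint I J
  disjoint_left_right : Disjoint I K
  disjoint_mid_right : Disjoint J K
  union_eq : I ∪ J ∪ K = univ

theorem IsTripartition.prod_univ {α M : Type*} [Fintype α] [DecidableEq α] [CommMonoid M]
    {I J K : Finset α} (hp : IsTripartition I J K) (f : α → M) :
    ∏ x, f x = (∏ x ∈ I, f x) * (∏ x ∈ J, f x) * ∏ x ∈ K, f x := by
  rw [← hp.union_eq, prod_union (disjoint_union_left.2
    ⟨hp.disjoint_left_right, hp.disjoint_mid_right⟩), prod_union hp.disjoint_left_mid]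

variable {d : ℕ} {n : Fin d → ℕ}

/-- The tensor product of the vectors `a x` for `x` in the block `X`, as a function of a full index
which ignores the coordinates outside `X`. Regrouping the factors of `outer a` by blocks reshapes
it to a tensor product of lower order. -/
def blockVec {A : Type*} [CommMonoid A] (X : Finset (Fin d)) (a : ∀ j : Fin d, Fin (n j) → A)
    (t : ∀ j : Fin d, Fin (n j)) : A :=
  ∏ x ∈ X, a x (t x)

theorem blockVec_congr {A : Type*} [CommMonoid A] {X : Finset (Fin d)}
    {a : ∀ j : Fin d, Fin (n j) → A} {t u : ∀ j : Fin d, Fin (n j)} (h : ∀ x ∈ X, t x = u x) :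
    blockVec X a t = blockVec X a u :=
  prod_congr rfl fun x hx => by rw [h x hx]

namespace IsTripartition

variable {F : Type*} [Field F] {I J K : Finset (Fin d)} {ι : Type*} {kI kJ kK : ℕ}

theorem outer_apply (hp : IsTripartition I J K) (a : ∀ j : Fin d, Fin (n j) → F)
    (t : ∀ j : Fin d, Fin (n j)) :
    outer a t = blockVec I a t * blockVec J a t * blockVec K a t :=
  hp.prod_univ fun j => a j (t j)

theorem exists_outer_apply_eq (hp : IsTripartition I J K) (x y z : ∀ j : Fin d, Fin (n j)) :
    ∃ t, ∀ a : ∀ j : Fin d, Fin (n j) → F,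
      outer a t = blockVec I a x * blockVec J a y * blockVec K a z := by
  refine ⟨fun j => if j ∈ I then x j else if j ∈ J then y j else z j, fun a => ?_⟩
  rw [hp.outer_apply, blockVec_congr (X := I) (u := x) fun j hj => if_pos hj,
    blockVec_congr (X := J) (u := y) fun j hj => ?_,
    blockVec_congr (X := K) (u := z) fun j hj => ?_]
  · rw [if_neg (disjoint_right.1 hp.disjoint_left_right hj),
      if_neg (disjoint_right.1 hp.disjoint_mid_right hj)]
  · rw [if_neg (disjoint_right.1 hp.disjoint_left_mid hj), if_pos hj]

theorem exists_perm_outer_eq [Fintype ι] (hp : IsTripartition I J K)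
    {a b : ι → ∀ j : Fin d, Fin (n j) → F}
    (hI : HasKRank F kI fun i => blockVec I (a i)) (hJ : HasKRank F kJ fun i => blockVec J (a i))
    (hK : HasKRank F kK fun i => blockVec K (a i))
    (hk : Fintype.card ι ≤ 1 ∨ 2 * Fintype.card ι + 2 ≤
      min kI (Fintype.card ι) + min kJ (Fintype.card ι) + min kK (Fintype.card ι))
    (h : ∑ i, outer (a i) = ∑ i, outer (b i)) :
    ∃ σ : Equiv.Perm ι, ∀ i, outer (b i) = outer (a (σ i)) := by
  rcases hk with hk | hk
  · have := Fintype.card_le_one_iff_subsingleton.1 hk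
    refine ⟨.refl ι, fun i => ?_⟩
    rw [Fintype.sum_subsingleton _ i, Fintype.sum_subsingleton _ i] at h
    exact h.symm
  · obtain ⟨σ, hσ⟩ := kruskal (A' := fun i => blockVec I (b i)) (B' := fun i => blockVec J (b i))
      (C' := fun i => blockVec K (b i)) hI hJ hK hk fun x y z => by
        obtain ⟨t, ht⟩ := hp.exists_outer_apply_eq (F := F) x y z
        have hxyz := congrFun h t
        simp only [Finset.sum_apply, ht] at hxyz
        exact hxyz
    refine ⟨σ, fun i => funext fun t => ?_⟩
    rw [hp.outer_apply, hp.outer_apply]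
    exact hσ i t t t

theorem outer_ne_zero (hp : IsTripartition I J K) {a : ∀ j : Fin d, Fin (n j) → F}
    (hI : blockVec I a ≠ 0) (hJ : blockVec J a ≠ 0) (hK : blockVec K a ≠ 0) : outer a ≠ 0 := by
  obtain ⟨x, hx⟩ := Function.ne_iff.1 hI
  obtain ⟨y, hy⟩ := Function.ne_iff.1 hJ
  obtain ⟨z, hz⟩ := Function.ne_iff.1 hK
  obtain ⟨t, ht⟩ := hp.exists_outer_apply_eq (F := F) x y z
  exact fun h => mul_ne_zero (mul_ne_zero hx hy) hz ((ht a).symm.trans (congrFun h t))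

theorem isIdentifiable_of_hasKRank [Fintype ι] (hp : IsTripartition I J K) (hd : 0 < d)
    {Ω : Type*} [Field Ω] [Algebra F Ω] {T : Tensor F n} (hT : tensorRank T ≤ Fintype.card ι)
    {a : ι → ∀ j : Fin d, Fin (n j) → Ω} (ha : ∑ i, outer (a i) = algebraMap F Ω ∘ T)
    (hI : HasKRank Ω kI fun i => blockVec I (a i)) (hJ : HasKRank Ω kJ fun i => blockVec J (a i))
    (hK : HasKRank Ω kK fun i => blockVec K (a i)) (hkI : 1 ≤ kI) (hkJ : 1 ≤ kJ) (hkK : 1 ≤ kK)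
    (hk : Fintype.card ι ≤ 1 ∨ 2 * Fintype.card ι + 2 ≤
      min kI (Fintype.card ι) + min kJ (Fintype.card ι) + min kK (Fintype.card ι)) :
    IsIdentifiable (Fintype.card ι) T := by
  have hinj : Function.Injective fun B : Tensor F n => algebraMap F Ω ∘ B :=
    (algebraMap F Ω).injective.comp_left
  have hmap (b : ∀ j : Fin d, Fin (n j) → F) :
      algebraMap F Ω ∘ outer b = outer fun j => algebraMap F Ω ∘ b j :=
    funext fun t => map_prod (algebraMap F Ω) _ _
  have hperm (b : ι → ∀ j : Fin d, Fin (n j) → F) (hb : ∑ i, outer (b i) = T) :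
      ∃ σ : Equiv.Perm ι, ∀ i, algebraMap F Ω ∘ outer (b i) = outer (a (σ i)) := by
    simp only [hmap]
    refine hp.exists_perm_outer_eq hI hJ hK hk (ha.trans ?_)
    simp only [← hb, ← hmap]
    ext t
    simp
  obtain ⟨a₀, ha₀⟩ := exists_sum_outer_eq (ι := ι) hd hT
  obtain ⟨σ₀, hσ₀⟩ := hperm a₀ ha₀
  refine isIdentifiable_of_forall_exists_perm hd ha₀ (fun i h0 => ?_) fun b hb => ?_
  · refine hp.outer_ne_zero (hI.ne_zero hkI (σ₀ i)) (hJ.ne_zero hkJ _) (hK.ne_zero hkK _) ?_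
    rw [← hσ₀, h0]
    exact funext fun _ => map_zero _
  · obtain ⟨σ, hσ⟩ := hperm b hb
    refine ⟨σ.trans σ₀.symm, fun i => hinj ?_⟩
    simp only [hσ, hσ₀, Equiv.trans_apply, Equiv.apply_symm_apply]

end IsTripartition

end Reshaping

section Parametrization

open Finset

variable {d m : ℕ} {n : Fin d → ℕ} {r : Fin m → ℕ}

/-- Indices of the parameters of a Hadamard product of sums of `r₁, …, r_m` tensor products: the
parameter `(⟨k, i⟩, ⟨j, l⟩)` is the `l`-th entry of the `j`-th vector in the `i`-th summand of the
`k`-th factor. -/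
abbrev Param (n : Fin d → ℕ) (r : Fin m → ℕ) : Type :=
  (Σ k : Fin m, Fin (r k)) × (Σ j : Fin d, Fin (n j))

/-- The vectors of the tensor product indexed by `i` when a Hadamard product of sums of tensor
products is expanded by distributivity. -/
def factor {A : Type*} [CommMonoid A] (p : Param n r → A) (i : ∀ k, Fin (r k)) (j : Fin d)
    (l : Fin (n j)) : A :=
  ∏ k, p (⟨k, i k⟩, ⟨j, l⟩)

/-- The parametrization of the Hadamard products of sums of `r₁, …, r_m` tensor products. -/
def hadamardMap {A : Type*} [CommSemiring A] (p : Param n r → A) (t : ∀ j : Fin d, Fin (n j)) : A :=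
  ∑ i : ∀ k, Fin (r k), blockVec univ (factor p i) t

theorem map_blockVec_factor {A B G : Type*} [CommMonoid A] [CommMonoid B] [FunLike G A B]
    [MonoidHomClass G A B] (g : G) (X : Finset (Fin d)) (p : Param n r → A) (i : ∀ k, Fin (r k))
    (t : ∀ j : Fin d, Fin (n j)) :
    g (blockVec X (factor p i) t) = blockVec X (factor (fun q => g (p q)) i) t := by
  simp [blockVec, factor]

theorem map_hadamardMap {A B G : Type*} [CommSemiring A] [CommSemiring B] [FunLike G A B]
    [RingHomClass G A B] (g : G) (p : Param n r → A) (t : ∀ j : Fin d, Fin (n j)) :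
    g (hadamardMap p t) = hadamardMap (fun q => g (p q)) t := by
  simp [hadamardMap, map_blockVec_factor]

variable {F : Type*} [Field F]

theorem sum_outer_factor (p : Param n r → F) :
    ∑ i : ∀ k, Fin (r k), outer (factor p i) = hadamardMap p := by
  ext t
  exact Finset.sum_apply ..

theorem prod_sum_outer (p : Param n r → F) :
    ∏ k, ∑ i : Fin (r k), outer (fun j l => p (⟨k, i⟩, ⟨j, l⟩)) = hadamardMap p := by
  ext t
  simp only [hadamardMap, blockVec, factor, Finset.prod_apply, Finset.sum_apply, outer]
  rw [prod_univ_sum, Fintype.piFinset_univ]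
  exact sum_congr rfl fun i _ => prod_comm

theorem hhdSet_eq_range (hd : 0 < d) :
    hhdSet F n r = Set.range fun p : Param n r → F => hadamardMap p := by
  ext T
  constructor
  · rintro ⟨G, hG, rfl⟩
    choose a ha using fun k => exists_sum_outer_eq (ι := Fin (r k)) hd (by simpa using hG k)
    refine ⟨fun q => a q.1.1 q.1.2 q.2.1 q.2.2, ?_⟩
    simp only [← prod_sum_outer, ha]
  · rintro ⟨p, rfl⟩
    refine ⟨_, fun k => ?_, (prod_sum_outer p).symm⟩
    exact (tensorRank_sum_outer_le _).trans_eq (Fintype.card_fin _)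

theorem tensorRank_le_of_mem_hhdSet (hd : 0 < d) {T : Tensor F n} (hT : T ∈ hhdSet F n r) :
    tensorRank T ≤ Fintype.card (∀ k, Fin (r k)) := by
  rw [hhdSet_eq_range hd] at hT
  obtain ⟨p, rfl⟩ := hT
  exact (congrArg tensorRank (sum_outer_factor p)).symm.trans_le (tensorRank_sum_outer_le _)

end Parametrization

section GenericKRank

open Finset

theorem linearIndepOn_of_det_ne_zero {F ι X : Type*} [Field F] {M : ι → X → F} {s : Finset ι}
    [DecidableEq s] (c : s → X) (h : (Matrix.of fun i j : s => M i (c j)).det ≠ 0) :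
    LinearIndepOn F M (s : Set ι) :=
  .of_comp (LinearMap.funLeft F F c) (Matrix.linearIndependent_rows_of_det_ne_zero h)

open MvPolynomial in
theorem exists_ne_zero_forall_hasKRank {F P ι X : Type*} [Field F] [Finite ι] [DecidableEq ι]
    {k : ℕ} (M : ι → X → MvPolynomial P F)
    (h : ∀ s : Finset ι, #s ≤ k → ∃ c : s → X, (Matrix.of fun i j : s => M i (c j)).det ≠ 0) :
    ∃ b : MvPolynomial P F, b ≠ 0 ∧ ∀ {Ω : Type*} [Field Ω] [Algebra F Ω] (p : P → Ω),
      aeval p b ≠ 0 → HasKRank Ω k fun i x => aeval p (M i x) := by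
  have := Fintype.ofFinite ι
  choose c hc using h
  refine ⟨∏ s : {s : Finset ι // #s ≤ k}, (Matrix.of fun i j : s.1 => M i (c s.1 s.2 j)).det,
    prod_ne_zero_iff.2 fun s _ => hc s.1 s.2, fun {Ω} _ _ p hp s hs => ?_⟩
  rw [map_prod, prod_ne_zero_iff] at hp
  have hdet := hp ⟨s, hs⟩ (mem_univ _)
  rw [AlgHom.map_det] at hdet
  exact linearIndepOn_of_det_ne_zero (c s hs) hdet

theorem exists_det_ne_zero_of_forall_exists_pow {A ι X : Type*} [CommRing A] [IsDomain A]
    [DecidableEq ι] {M : ι → X → A} {v : ι → A} (hv : Function.Injective v) {s : Finset ι}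
    (hM : ∀ e < #s, ∃ x, ∀ i, M i x = v i ^ e) :
    ∃ c : s → X, (Matrix.of fun i j : s => M i (c j)).det ≠ 0 := by
  choose x hx using fun e : Fin #s => hM e e.2
  refine ⟨fun j => x (s.equivFin j), ?_⟩
  have hvand : Matrix.of (fun i j : s => M i (x (s.equivFin j))) =
      (Matrix.vandermonde fun u => v (s.equivFin.symm u)).submatrix s.equivFin s.equivFin := by
    ext i j
    simp [hx, Matrix.vandermonde_apply]
  rw [hvand, Matrix.det_submatrix_equiv_self, Matrix.det_vandermonde_ne_zero_iff]
  exact hv.comp (Subtype.val_injective.comp s.equivFin.symm.injective)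

variable {d m : ℕ} {n : Fin d → ℕ} {r : Fin m → ℕ}

theorem exists_weights_sum_mul_eq [∀ j, NeZero (n j)] (X : Finset (Fin d)) :
    ∃ w : Fin d → ℕ, ∀ e < ∏ x ∈ X, n x,
      ∃ t : ∀ j : Fin d, Fin (n j), ∑ x ∈ X, (t x : ℕ) * w x = e := by
  let n' (j : Fin d) : ℕ := if j ∈ X then n j else 1
  have hn' : ∏ j, n' j = ∏ x ∈ X, n x := by simp [n', prod_ite_mem]
  refine ⟨fun j => ∏ i : Fin j, n' (Fin.castLE j.is_lt.le i), fun e he => ?_⟩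
  let t' : ∀ j, Fin (n' j) := finPiFinEquiv.symm ⟨e, hn' ▸ he⟩
  have ht' : ∑ j, (t' j : ℕ) * ∏ i : Fin j, n' (Fin.castLE j.is_lt.le i) = e := by
    rw [← finPiFinEquiv_apply, Equiv.apply_symm_apply]
  refine ⟨fun j => Fin.ofNat (n j) (t' j), ?_⟩
  rw [← ht', ← sum_subset (subset_univ X) fun j _ hj => ?_]
  · refine sum_congr rfl fun j hj => ?_
    rw [Fin.val_ofNat, Nat.mod_eq_of_lt ((t' j).2.trans_eq (if_pos hj))]
  · have : (t' j : ℕ) < 1 := (t' j).2.trans_eq (if_neg hj)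
    rw [Nat.lt_one_iff.1 this, zero_mul]

/-- Parameters that are powers of `u`, with exponents chosen so that the entry of the block vector
with index `i` at `t` is a power of `u ^ finPiFinEquiv i`, of exponent `t` weighted by `w`. -/
def vandermondeParam {A : Type*} [CommMonoid A] (n : Fin d → ℕ) (r : Fin m → ℕ) (u : A)
    (w : Fin d → ℕ) : Param n r → A :=
  fun q => u ^ (((q.1.2 : ℕ) * ∏ j, r (Fin.castLE q.1.1.is_lt.le j)) * ((q.2.2 : ℕ) * w q.2.1))

theorem blockVec_factor_vandermondeParam {A : Type*} [CommMonoid A] (u : A) (w : Fin d → ℕ)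
    (X : Finset (Fin d)) (i : ∀ k, Fin (r k)) (t : ∀ j, Fin (n j)) :
    blockVec X (factor (vandermondeParam n r u w) i) t =
      (u ^ (finPiFinEquiv i : ℕ)) ^ (∑ x ∈ X, (t x : ℕ) * w x) := by
  simp only [blockVec, factor, vandermondeParam]
  rw [← prod_pow_eq_pow_sum]
  refine prod_congr rfl fun x _ => ?_
  rw [prod_pow_eq_pow_sum, ← pow_mul, finPiFinEquiv_apply, sum_mul]

theorem exists_det_blockVec_factor_ne_zero (F : Type*) [Field F] [∀ j, NeZero (n j)]
    (X : Finset (Fin d)) {s : Finset (∀ k, Fin (r k))} (hs : #s ≤ ∏ x ∈ X, n x) :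
    ∃ c : s → ∀ j, Fin (n j), (Matrix.of fun i j : s =>
      blockVec X (factor (MvPolynomial.X (R := F)) i.1) (c j)).det ≠ 0 := by
  obtain ⟨w, hw⟩ := exists_weights_sum_mul_eq (n := n) X
  let p := vandermondeParam n r (Polynomial.X : Polynomial F) w
  have hinj : Function.Injective fun i : ∀ k, Fin (r k) =>
      (Polynomial.X : Polynomial F) ^ (finPiFinEquiv i : ℕ) := fun i j hij =>
    finPiFinEquiv.injective <| Fin.ext <| by
      simpa using congrArg Polynomial.natDegree hij
  obtain ⟨c, hc⟩ := exists_det_ne_zero_of_forall_exists_pow (s := s)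
    (M := fun i => blockVec X (factor p i)) hinj fun e he => by
      obtain ⟨t, ht⟩ := hw e (he.trans_le hs)
      exact ⟨t, fun i => by rw [blockVec_factor_vandermondeParam, ht]⟩
  refine ⟨c, fun h0 => hc ?_⟩
  have hp := congrArg (MvPolynomial.aeval p) h0
  rw [AlgHom.map_det, map_zero] at hp
  rw [← hp]
  congr 1
  ext i j
  simp [map_blockVec_factor]

theorem exists_ne_zero_forall_hasKRank_blockVec (F : Type*) [Field F] (n : Fin d → ℕ)
    [∀ j, NeZero (n j)] (r : Fin m → ℕ) :
    ∃ b : MvPolynomial (Param n r) F, b ≠ 0 ∧ ∀ {Ω : Type*} [Field Ω] [Algebra F Ω]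
      (p : Param n r → Ω), MvPolynomial.aeval p b ≠ 0 → ∀ X : Finset (Fin d),
        HasKRank Ω (∏ x ∈ X, n x) fun i => blockVec X (factor p i) := by
  choose b hb H using fun X : Finset (Fin d) => exists_ne_zero_forall_hasKRank
    (fun i : ∀ k, Fin (r k) => blockVec X (factor (n := n) (MvPolynomial.X (R := F)) i))
    fun _ hs => exists_det_blockVec_factor_ne_zero F X hs
  refine ⟨∏ X, b X, prod_ne_zero_iff.2 fun X _ => hb X, fun p hp X => ?_⟩
  rw [map_prod, prod_ne_zero_iff] at hp
  simpa only [map_blockVec_factor, MvPolynomial.aeval_X] using! H X p (hp X (mem_univ X))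

end GenericKRank

open Finset in
theorem generically_exists_hasKRank {𝕜 : Type*} [Field 𝕜] [Infinite 𝕜] (Ω : Type*) [Field Ω]
    [IsAlgClosed Ω] [Algebra 𝕜 Ω] {d m : ℕ} (hd : 0 < d) (n : Fin d → ℕ) [∀ j, NeZero (n j)]
    (r : Fin m → ℕ) :
    Generically (hhdVariety 𝕜 n r) fun T =>
      ∃ p : Param n r → Ω, hadamardMap p = algebraMap 𝕜 Ω ∘ T ∧
        ∀ X : Finset (Fin d), HasKRank Ω (∏ x ∈ X, n x) fun i => blockVec X (factor p i) := by
  obtain ⟨b, hb, H⟩ := exists_ne_zero_forall_hasKRank_blockVec 𝕜 n r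
  have hgen := generically_exists_aeval_eq Ω
    (hadamardMap (MvPolynomial.X : Param n r → MvPolynomial (Param n r) 𝕜)) hb
  simp only [map_hadamardMap, MvPolynomial.aeval_X] at hgen
  rw [hhdVariety, hhdSet_eq_range hd]
  exact hgen.mono fun T _ ⟨p, hpb, hpT⟩ => ⟨p, funext hpT, H p hpb⟩

namespace InKruskalRange

open Finset

variable {d : ℕ} {n : Fin d → ℕ} {I J K : Finset (Fin d)} {R : ℕ}

theorem le_one_or_two_mul_add_two_le (h : InKruskalRange n I J K R) :
    R ≤ 1 ∨ 2 * R + 2 ≤ min (∏ x ∈ I, n x) R + min (∏ x ∈ J, n x) R + min (∏ x ∈ K, n x) R := by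
  obtain ⟨hJI, hKJ, hK, h⟩ := h
  have hhalf := h.trans (add_le_add_right (min_le_left _ _) _)
  have hfull := h.trans (add_le_add_right (min_le_right _ _) _)
  have hJK : R + 2 ≤ ∏ x ∈ J, n x + ∏ x ∈ K, n x := by
    have : (R : ℚ) + 2 ≤ ∏ x ∈ J, (n x : ℚ) + ∏ x ∈ K, (n x : ℚ) := by linarith
    exact_mod_cast this
  have hIJK : 2 * R + 2 ≤ ∏ x ∈ I, n x + ∏ x ∈ J, n x + ∏ x ∈ K, n x := by
    have : 2 * (R : ℚ) + 2 ≤ ∏ x ∈ I, (n x : ℚ) + ∏ x ∈ J, (n x : ℚ) + ∏ x ∈ K, (n x : ℚ) := by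
      linarith
    exact_mod_cast this
  omega

theorem prod_pos (h : InKruskalRange n I J K R) :
    0 < ∏ x ∈ I, n x ∧ 0 < ∏ x ∈ J, n x ∧ 0 < ∏ x ∈ K, n x := by
  obtain ⟨hJI, hKJ, hK, -⟩ := h
  omega

theorem dim_pos (h : InKruskalRange n I J K R) : 0 < d := by
  obtain ⟨x, -⟩ : K.Nonempty := nonempty_of_prod_ne_one (f := n) (by have := h.2.2.1; omega)
  exact x.pos

theorem ne_zero (h : InKruskalRange n I J K R) (hp : IsTripartition I J K) (j : Fin d) :
    n j ≠ 0 := by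
  obtain ⟨hI, hJ, hK⟩ := h.prod_pos
  have hprod : ∏ x, n x ≠ 0 := by
    rw [hp.prod_univ]
    positivity
  exact prod_ne_zero_iff.1 hprod j (mem_univ j)

theorem generically_isIdentifiable {𝕜 : Type*} [Field 𝕜] [Infinite 𝕜] (Ω : Type*) [Field Ω]
    [IsAlgClosed Ω] [Algebra 𝕜 Ω] {m : ℕ} {r : Fin m → ℕ} (hp : IsTripartition I J K)
    (hR : InKruskalRange n I J K (∏ k, r k)) :
    Generically (hhdVariety 𝕜 n r) fun T =>
      (∃ p : Param n r → Ω, hadamardMap p = algebraMap 𝕜 Ω ∘ T) ∧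
        (T ∈ hhdSet 𝕜 n r → IsIdentifiable (∏ k, r k) T) := by
  have (j : Fin d) : NeZero (n j) := ⟨hR.ne_zero hp j⟩
  have hcard : Fintype.card (∀ k, Fin (r k)) = ∏ k, r k := by simp
  obtain ⟨hI, hJ, hK⟩ := hR.prod_pos
  refine (generically_exists_hasKRank Ω hR.dim_pos n r).mono fun T _ ⟨p, hpT, H⟩ =>
    ⟨⟨p, hpT⟩, fun hT => ?_⟩
  rw [← hcard] at hR ⊢
  exact hp.isIdentifiable_of_hasKRank hR.dim_pos (tensorRank_le_of_mem_hhdSet hR.dim_pos hT)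
    ((sum_outer_factor p).trans hpT) (H I) (H J) (H K) hI hJ hK hR.le_one_or_two_mul_add_two_le

end InKruskalRange

end HHD

theorem mainTheorem2_general {𝕜 : Type*} [Field 𝕜] [Infinite 𝕜] {d m : ℕ} (n : Fin d → ℕ)
    (r : Fin m → ℕ) (I J K : Finset (Fin d))
    (hIJ : Disjoint I J) (hIK : Disjoint I K) (hJK : Disjoint J K)
    (hIJK : I ∪ J ∪ K = Finset.univ)
    (hR : HHD.InKruskalRange n I J K (∏ k, r k)) :
    HHD.Generically (HHD.hhdVariety 𝕜 n r)
      (fun T => T ∈ HHD.hhdSet 𝕜 n r → HHD.IsIdentifiable (∏ k, r k) T) ∧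
    (IsAlgClosed 𝕜 →
      HHD.Generically (HHD.hhdVariety 𝕜 n r) (HHD.IsIdentifiable (∏ k, r k))) := by
  have hp : HHD.IsTripartition I J K := ⟨hIJ, hIK, hJK, hIJK⟩
  refine ⟨(hR.generically_isIdentifiable (AlgebraicClosure 𝕜) hp).mono fun _ _ h => h.2,
    fun _ => (hR.generically_isIdentifiable 𝕜 hp).mono fun T _ ⟨⟨p, hpT⟩, hT⟩ => hT ?_⟩
  rw [HHD.hhdSet_eq_range hR.dim_pos]
  exact ⟨p, hpT⟩

theorem mainTheorem2 {𝕜 : Type*} [Field 𝕜] [CharZero 𝕜] {d m : ℕ} (n : Fin d → ℕ)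
    (r : Fin m → ℕ) (hr : ∀ k, 1 ≤ r k) (I J K : Finset (Fin d))
    (hIJ : Disjoint I J) (hIK : Disjoint I K) (hJK : Disjoint J K)
    (hIJK : I ∪ J ∪ K = Finset.univ)
    (hR : HHD.InKruskalRange n I J K (∏ k, r k)) :
    HHD.Generically (HHD.hhdVariety 𝕜 n r)
      (fun T => T ∈ HHD.hhdSet 𝕜 n r → HHD.IsIdentifiable (∏ k, r k) T) ∧
    (IsAlgClosed 𝕜 →
      HHD.Generically (HHD.hhdVariety 𝕜 n r) (HHD.IsIdentifiable (∏ k, r k))) :=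
  mainTheorem2_general n r I J K hIJ hIK hJK hIJK hR
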